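/- Fix reference bases of finite-dimensional complex Hilbert spaces $\mathcal H_A$ and $\mathcal H_B$ (of arbitrary, possibly different dimensions). For a pure state (unit vector) $|\psi\rangle$ let $$\mathscr I_g(|\psi\rangle)=1-\max_{|\phi\rangle}|\langle\phi|\psi\rangle|^2,$$ where the maximum is over all unit vectors $|\phi\rangle$ with real components in the reference basis, and for a density matrix $\rho$ let $$\mathscr I_g(\rho)=\min\sum_j p_j\,\mathscr I_g(|\psi_j\rangle),$$ where the minimum is over all finite pure-state decompositions $\rho=\sum_j p_j|\psi_j\rangle\langle\psi_j|$ (with $p_j\ge 0$, $\sum_j p_j=1$). A real operation is a completely positive trace non-increasing map $\Lambda(X)=\sum_m K_mXK_m^\dagger$ whose (finitely many) Kraus operators $K_m$ have real matrix entries in the reference bases. The optimal probability $P(|\psi\rangle\to\rho)$ of transforming $|\psi\rangle$ into $\rho$ is the largest $p$ for which there is a real operation $\Lambda$ with $\operatorname{tr}\Lambda(|\psi\rangle\langle\psi|)=p$ and $\Lambda(|\psi\rangle\langle\psi|)=p\,\rho$ (the value $p=0$ means that the transformation is impossible). **Theorem.** For every pure state $|\psi\rangle$ on $\mathcal H_A$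 and every density matrix $\rho$ on $\mathcal H_B$, this maximum exists and $$P(|\psi\rangle\to\rho)=\min\left[\frac{\mathscr I_g(|\psi\rangle)}{\mathscr I_g(\rho)},\,1\right],$$ where the right-hand side is read as $1$ if $\mathscr I_g(\rho)=0$. -/

import Mathlib

open scoped ComplexOrder

namespace RealQuantum

/-- A density matrix on `ℂ^ι`: positive semidefinite with unit trace. -/
def IsDensityMatrix {ι : Type*} [Fintype ι] (ρ : Matrix ι ι ℂ) : Prop :=
  ρ.PosSemidef ∧ ρ.trace = 1

/-- The operator `|ψ⟩⟨ψ|` in the reference basis. -/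
def ketbra {ι : Type*} (ψ : EuclideanSpace ℂ ι) : Matrix ι ι ℂ :=
  Matrix.of fun i j => ψ i * star (ψ j)

/-- A real pure state: a unit vector with real components in the reference basis. -/
def IsRealPureState {ι : Type*} [Fintype ι] (φ : EuclideanSpace ℂ ι) : Prop :=
  ‖φ‖ = 1 ∧ ∀ i, (φ i).im = 0

/-- Geometric imaginarity of a pure state: `1 - max |⟨φ|ψ⟩|²` over real pure states `φ`
(the supremum is over a nonempty compact set when `ι` is nonempty, hence a maximum). -/
noncomputable def pureImaginarity {ι : Type*} [Fintype ι] (ψ : EuclideanSpace ℂ ι) : ℝ :=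
  1 - sSup {t : ℝ | ∃ φ : EuclideanSpace ℂ ι, IsRealPureState φ ∧ t = ‖inner ℂ φ ψ‖ ^ 2}

/-- `(p, ψ)` is a finite pure-state decomposition `ρ = ∑ⱼ pⱼ |ψⱼ⟩⟨ψⱼ|`. -/
structure IsEnsemble {ι : Type*} [Fintype ι] {r : ℕ} (p : Fin r → ℝ)
    (ψ : Fin r → EuclideanSpace ℂ ι) (ρ : Matrix ι ι ℂ) : Prop where
  nonneg : ∀ j, 0 ≤ p j
  sum_eq_one : ∑ j, p j = 1
  norm_eq_one : ∀ j, ‖ψ j‖ = 1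
  decomposition : ρ = ∑ j, (p j : ℂ) • ketbra (ψ j)

/-- Geometric imaginarity of a density matrix: the least average imaginarity over all
pure-state decompositions. -/
noncomputable def imaginarity {ι : Type*} [Fintype ι] (ρ : Matrix ι ι ℂ) : ℝ :=
  sInf {s : ℝ | ∃ (r : ℕ) (p : Fin r → ℝ) (ψ : Fin r → EuclideanSpace ℂ ι),
    IsEnsemble p ψ ρ ∧ s = ∑ j, p j * pureImaginarity (ψ j)}

/-- A (stochastic) real operation from `ℂ^ι` to `ℂ^κ`: a trace non-increasing map given by
finitely many Kraus operators with real entries (in particular completely positive). -/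
def IsRealOperation {ι κ : Type*} [Fintype ι] [Fintype κ]
    (Λ : Matrix ι ι ℂ →ₗ[ℂ] Matrix κ κ ℂ) : Prop :=
  (∃ (r : ℕ) (K : Fin r → Matrix κ ι ℂ),
      (∀ m i j, (K m i j).im = 0) ∧ ∀ X, Λ X = ∑ m, K m * X * (K m).conjTranspose) ∧
    ∀ X : Matrix ι ι ℂ, X.PosSemidef → (Λ X).trace.re ≤ X.trace.re

/-- The probabilities with which `σ` can be transformed into `ρ` by real operations: `p` is the
trace of the unnormalized output `Λ(σ)`, and that output is `p ρ`, so that for `p > 0` the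
normalized output is exactly `ρ`. The value `p = 0` (never succeeding) is always included. -/
def transformationProbabilities {ι κ : Type*} [Fintype ι] [Fintype κ]
    (σ : Matrix ι ι ℂ) (ρ : Matrix κ κ ℂ) : Set ℝ :=
  {p : ℝ | ∃ Λ : Matrix ι ι ℂ →ₗ[ℂ] Matrix κ κ ℂ, IsRealOperation Λ ∧
    (Λ σ).trace = (p : ℂ) ∧ Λ σ = (p : ℂ) • ρ}

end RealQuantum

namespace RealQuantum

/-! Multiplying a vector by a phase leaves its projector unchanged. For unit `ψ` the least `imSq`
over phases is `(1 - ‖∑ ψᵢ²‖) / 2 = pureImaginarity ψ`, and at the minimising phase the real and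
imaginary parts are orthogonal. So imaginarity is a squared norm of an imaginary part.

Upper bound (`mul_imaginarity_le`): a real Kraus operator acts separately on real and imaginary
parts, so trace non-increase applied to the imaginary part alone bounds the total `imSq` of the
outputs.

Attainment: by compactness some decomposition `χ` of `ρ` has total `imSq` equal to `imaginarity ρ`
(`exists_optimal_decomposition`). The real maps sending `Re ψ`, `Im ψ` to `Re χₖ`, `Im χₖ` are
jointly contractive once the total real and imaginary weights of `χ` do not exceed those of `ψ` and
the total cross term vanishes (`exists_isRealOperation`). Scaling `χ` by `p` suffices if `ψ` is less
imaginary than `ρ`; otherwise phase rotations of `χ` raise its imaginary weight to match `ψ`. -/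

/-! ### Compactness of convex hulls. -/

/-- The convex hull of a compact set in a finite-dimensional space is compact. -/
theorem isCompact_convexHull_of_isCompact {E : Type*} [AddCommGroup E] [Module ℝ E]
    [TopologicalSpace E] [ContinuousAdd E] [ContinuousSMul ℝ E] [FiniteDimensional ℝ E]
    {s : Set E} (hs : IsCompact s) : IsCompact (convexHull ℝ s) := by
  classical
  rcases s.eq_empty_or_nonempty with rfl | ⟨x₀, hx₀⟩
  · simp
  set N := Module.finrank ℝ E + 1
  -- Carathéodory: `finrank + 1` points always suffice, so the hull is a continuous image of one
  -- compact set.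
  have key : convexHull ℝ s = (fun q : (Fin N → ℝ) × (Fin N → E) => ∑ i, q.1 i • q.2 i) ''
      (stdSimplex ℝ (Fin N) ×ˢ Set.univ.pi fun _ => s) := by
    apply Set.Subset.antisymm
    · intro x hx
      obtain ⟨ι, _, z, w, hz, hind, hw, hw1, rfl⟩ := eq_pos_convex_span_of_mem_convexHull hx
      have hcard : Fintype.card ι ≤ Fintype.card (Fin N) := by
        rw [Fintype.card_fin]
        exact hind.card_le_finrank_succ.trans
          (Nat.succ_le_succ (Submodule.finrank_le _))
      obtain ⟨e⟩ := Function.Embedding.nonempty_of_card_le hcard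
      have hval : ∀ i, Function.extend e z (fun _ => x₀) (e i) = z i :=
        fun i => e.injective.extend_apply z _ i
      have hwal : ∀ i, Function.extend e w 0 (e i) = w i :=
        fun i => e.injective.extend_apply w _ i
      have hw0 : ∀ j, j ∉ Set.range e → Function.extend e w 0 j = 0 :=
        fun j hj => Function.extend_apply' _ _ _ hj
      -- Unused slots are padded with weight `0` and the point `x₀`.
      refine ⟨(Function.extend e w 0, Function.extend e z fun _ => x₀), ⟨⟨?_, ?_⟩, ?_⟩, ?_⟩
      · intro j
        by_cases hj : j ∈ Set.range e
        · obtain ⟨i, rfl⟩ := hj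
          simpa only [hwal] using (hw i).le
        · simp only [hw0 j hj]; exact le_rfl
      · rw [← hw1]
        symm
        exact Fintype.sum_of_injective e e.injective _ _ (fun j hj => hw0 j hj)
          (fun i => (hwal i).symm)
      · intro j _
        by_cases hj : j ∈ Set.range e
        · obtain ⟨i, rfl⟩ := hj
          simp only [hval]
          exact hz ⟨i, rfl⟩
        · simp only [Function.extend_apply' _ _ _ hj]; exact hx₀
      · symm
        refine Fintype.sum_of_injective e e.injective _ _ (fun j hj => ?_) (fun i => ?_)
        · simp only [hw0 j hj, zero_smul]
        · simp only [hwal, hval]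
    · rintro _ ⟨⟨w, z⟩, ⟨hw, hz⟩, rfl⟩
      exact mem_convexHull_of_exists_fintype w z hw.1 hw.2 (fun i => hz i trivial) rfl
  rw [key]
  refine ((isCompact_stdSimplex ℝ _).prod (isCompact_univ_pi fun _ => hs)).image ?_
  fun_prop

/-! ### Real and imaginary weights, projectors and phases. -/

variable {ι κ : Type*} [Fintype ι] [Fintype κ]

/-- Squared norm of the componentwise real part. -/
noncomputable def reSq (ψ : EuclideanSpace ℂ ι) : ℝ := ∑ i, (ψ i).re ^ 2

/-- Squared norm of the componentwise imaginary part. -/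
noncomputable def imSq (ψ : EuclideanSpace ℂ ι) : ℝ := ∑ i, (ψ i).im ^ 2

/-- Inner product of the componentwise real and imaginary parts. -/
noncomputable def reIm (ψ : EuclideanSpace ℂ ι) : ℝ := ∑ i, (ψ i).re * (ψ i).im

theorem reSq_nonneg (ψ : EuclideanSpace ℂ ι) : 0 ≤ reSq ψ :=
  Finset.sum_nonneg fun _ _ => sq_nonneg _

theorem imSq_nonneg (ψ : EuclideanSpace ℂ ι) : 0 ≤ imSq ψ :=
  Finset.sum_nonneg fun _ _ => sq_nonneg _

theorem reSq_add_imSq (ψ : EuclideanSpace ℂ ι) : reSq ψ + imSq ψ = ‖ψ‖ ^ 2 := by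
  rw [EuclideanSpace.norm_sq_eq, reSq, imSq, ← Finset.sum_add_distrib]
  refine Finset.sum_congr rfl fun i _ => ?_
  rw [Complex.sq_norm, Complex.normSq_apply]; ring

theorem continuous_imSq : Continuous (imSq : EuclideanSpace ℂ ι → ℝ) := by
  unfold imSq; fun_prop

theorem continuous_ketbra {ι : Type*} :
    Continuous (ketbra : EuclideanSpace ℂ ι → Matrix ι ι ℂ) := by
  unfold ketbra
  refine continuous_matrix fun i j => ?_
  simp only [Matrix.of_apply]
  fun_prop

theorem imSq_real_smul (c : ℝ) (ψ : EuclideanSpace ℂ ι) :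
    imSq ((c : ℂ) • ψ) = c ^ 2 * imSq ψ := by
  simp [imSq, Finset.mul_sum, mul_pow]

theorem reSq_real_smul (c : ℝ) (ψ : EuclideanSpace ℂ ι) :
    reSq ((c : ℂ) • ψ) = c ^ 2 * reSq ψ := by
  simp [reSq, Finset.mul_sum, mul_pow]

theorem reIm_real_smul (c : ℝ) (ψ : EuclideanSpace ℂ ι) :
    reIm ((c : ℂ) • ψ) = c ^ 2 * reIm ψ := by
  simp only [reIm, PiLp.smul_apply, smul_eq_mul, Complex.re_ofReal_mul, Complex.im_ofReal_mul,
    Finset.mul_sum]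
  exact Finset.sum_congr rfl fun i _ => by ring

theorem ketbra_smul {ι : Type*} (c : ℂ) (ψ : EuclideanSpace ℂ ι) :
    ketbra (c • ψ) = ((‖c‖ ^ 2 : ℝ) : ℂ) • ketbra ψ := by
  ext i j
  simp only [ketbra, Matrix.of_apply, Matrix.smul_apply, PiLp.smul_apply, smul_eq_mul, star_mul']
  have : c * star c = ((‖c‖ ^ 2 : ℝ) : ℂ) := by
    rw [Complex.ofReal_pow, ← Complex.mul_conj']; rfl
  rw [← this]; ring

theorem ketbra_smul_of_norm_eq_one {ι : Type*} {c : ℂ} (hc : ‖c‖ = 1) (ψ : EuclideanSpace ℂ ι) :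
    ketbra (c • ψ) = ketbra ψ := by
  rw [ketbra_smul, hc]; simp

theorem trace_ketbra (ψ : EuclideanSpace ℂ ι) :
    (ketbra ψ).trace = ((‖ψ‖ ^ 2 : ℝ) : ℂ) := by
  rw [EuclideanSpace.norm_sq_eq, Complex.ofReal_sum]
  refine Finset.sum_congr rfl fun i _ => ?_
  simp only [Matrix.diag_apply, ketbra, Matrix.of_apply]
  push_cast
  rw [← Complex.mul_conj']; rfl

theorem posSemidef_ketbra (ψ : EuclideanSpace ℂ ι) : (ketbra ψ).PosSemidef :=
  Matrix.posSemidef_vecMulVec_self_star (R := ℂ) (fun i => ψ i)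

theorem exists_eq_sum_ketbra {X : Matrix ι ι ℂ} (hX : X.PosSemidef) :
    ∃ (r : ℕ) (z : Fin r → EuclideanSpace ℂ ι), X = ∑ k, ketbra (z k) := by
  obtain ⟨r, v, rfl⟩ := Matrix.posSemidef_iff_eq_sum_vecMulVec.1 hX
  exact ⟨r, fun k => WithLp.toLp 2 (v k), rfl⟩

theorem mul_ketbra_mul_conjTranspose {κ : Type*} (K : Matrix κ ι ℂ) (ψ : EuclideanSpace ℂ ι) :
    K * ketbra ψ * K.conjTranspose = ketbra (WithLp.toLp 2 (K.mulVec ψ)) := by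
  have h : ∀ {α : Type _} (v : EuclideanSpace ℂ α),
      ketbra v = Matrix.vecMulVec v (star (v : α → ℂ)) := fun _ => rfl
  rw [h ψ, Matrix.mul_vecMulVec, Matrix.vecMulVec_mul, ← Matrix.star_mulVec]
  rfl

/-- `imSq` after a phase rotation: only the scalar `∑ᵢ ψᵢ²` matters. -/
theorem two_mul_imSq_eq (ψ : EuclideanSpace ℂ ι) :
    2 * imSq ψ = ‖ψ‖ ^ 2 - (∑ i, ψ i ^ 2).re := by
  rw [← reSq_add_imSq, Complex.re_sum, reSq, imSq, Finset.mul_sum, ← Finset.sum_add_distrib,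
    ← Finset.sum_sub_distrib]
  refine Finset.sum_congr rfl fun i _ => ?_
  rw [sq (ψ i), Complex.mul_re]; ring

theorem two_mul_reIm_eq (ψ : EuclideanSpace ℂ ι) : 2 * reIm ψ = (∑ i, ψ i ^ 2).im := by
  rw [Complex.im_sum, reIm, Finset.mul_sum]
  refine Finset.sum_congr rfl fun i _ => ?_
  rw [sq (ψ i), Complex.mul_im]; ring

theorem sum_sq_smul (c : ℂ) (ψ : EuclideanSpace ℂ ι) :
    ∑ i, (c • ψ) i ^ 2 = c ^ 2 * ∑ i, ψ i ^ 2 := by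
  simp [Finset.mul_sum, mul_pow]

/-- A phase rotating a complex number onto the nonnegative real axis. -/
theorem exists_phase (z : ℂ) : ∃ c : ℂ, ‖c‖ = 1 ∧ c * z = (‖z‖ : ℂ) := by
  refine ⟨Complex.exp (-(z.arg : ℂ) * Complex.I), ?_, ?_⟩
  · rw [← Complex.ofReal_neg, Complex.norm_exp_ofReal_mul_I]
  · have h := Complex.norm_mul_exp_arg_mul_I z
    calc Complex.exp (-(z.arg : ℂ) * Complex.I) * z
        = Complex.exp (-(z.arg : ℂ) * Complex.I) *
          (‖z‖ * Complex.exp (z.arg * Complex.I)) := by rw [h]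
      _ = ‖z‖ * Complex.exp (-(z.arg : ℂ) * Complex.I + z.arg * Complex.I) := by
          rw [Complex.exp_add]; ring
      _ = ‖z‖ := by simp

/-- The square appears because `∑ ψᵢ²` picks up `c ^ 2` when `ψ` is multiplied by `c`. -/
theorem exists_phase_sq (z : ℂ) : ∃ c : ℂ, ‖c‖ = 1 ∧ c ^ 2 * z = (‖z‖ : ℂ) := by
  obtain ⟨d, hd, hdz⟩ := exists_phase z
  obtain ⟨c, hc⟩ := IsAlgClosed.exists_pow_nat_eq d (n := 2) (by norm_num)
  refine ⟨c, ?_, by rw [hc, hdz]⟩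
  have : ‖c‖ ^ 2 = 1 := by rw [← norm_pow, hc, hd]
  exact (pow_eq_one_iff_of_nonneg (norm_nonneg c) two_ne_zero).1 this

/-! ### Imaginarity of pure states. -/

theorem inner_eq_sum_of_real {φ : EuclideanSpace ℂ ι} (hφ : ∀ i, (φ i).im = 0)
    (ψ : EuclideanSpace ℂ ι) : (inner ℂ φ ψ).re = ∑ i, (φ i).re * (ψ i).re := by
  rw [PiLp.inner_apply, Complex.re_sum]
  refine Finset.sum_congr rfl fun i _ => ?_
  simp [hφ i, mul_comm]

/-- Overlap bound: a real pure state overlaps `ψ` by at most the largest real part norm. -/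
theorem norm_inner_sq_le {φ : EuclideanSpace ℂ ι} (hφ : IsRealPureState φ)
    (ψ : EuclideanSpace ℂ ι) :
    ‖inner ℂ φ ψ‖ ^ 2 ≤ (‖ψ‖ ^ 2 + ‖∑ i, ψ i ^ 2‖) / 2 := by
  -- With this phase the overlap is real, hence equals the overlap of `φ` with the real part of `c •
  -- ψ`; Cauchy–Schwarz then applies.
  obtain ⟨c, hc, hcz⟩ := exists_phase (inner ℂ φ ψ)
  have h1 : ‖inner ℂ φ ψ‖ = ∑ i, (φ i).re * ((c • ψ) i).re := by
    rw [← inner_eq_sum_of_real hφ.2, inner_smul_right, hcz, Complex.ofReal_re]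
  have h2 : ‖inner ℂ φ ψ‖ ^ 2 ≤ reSq (c • ψ) := by
    have hr : reSq φ = 1 := by
      have := reSq_add_imSq φ
      rw [hφ.1, imSq] at this
      simpa [hφ.2] using this
    rw [h1]
    refine (Finset.sum_mul_sq_le_sq_mul_sq _ _ _).trans ?_
    rw [show (∑ i, (φ i).re ^ 2) = 1 from hr, one_mul]
    exact le_rfl
  have h3 := reSq_add_imSq (c • ψ)
  have h4 := two_mul_imSq_eq (c • ψ)
  have h5 : -(∑ i, (c • ψ) i ^ 2).re ≥ -‖∑ i, ψ i ^ 2‖ := by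
    rw [sum_sq_smul]
    have := Complex.re_le_norm (c ^ 2 * ∑ i, ψ i ^ 2)
    rw [norm_mul, norm_pow, hc] at this
    linarith
  rw [norm_smul, hc, one_mul] at h3 h4
  linarith

/-- The componentwise real part of a vector. -/
noncomputable def rePart (ψ : EuclideanSpace ℂ ι) : EuclideanSpace ℂ ι :=
  WithLp.toLp 2 fun i => ((ψ i).re : ℂ)

theorem norm_rePart_sq (ψ : EuclideanSpace ℂ ι) : ‖rePart ψ‖ ^ 2 = reSq ψ := by
  rw [← reSq_add_imSq]; simp [reSq, imSq, rePart]

/-- The bound `norm_inner_sq_le` is attained by the normalised real part of `c • ψ`, where `c ^ 2`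
rotates `∑ ψᵢ²` onto the nonnegative axis. -/
theorem pureImaginarity_eq {ψ : EuclideanSpace ℂ ι} (hψ : ‖ψ‖ = 1) :
    pureImaginarity ψ = (1 - ‖∑ i, ψ i ^ 2‖) / 2 := by
  have hle : ∀ t ∈ {t : ℝ | ∃ φ : EuclideanSpace ℂ ι, IsRealPureState φ ∧
      t = ‖inner ℂ φ ψ‖ ^ 2}, t ≤ (1 + ‖∑ i, ψ i ^ 2‖) / 2 := by
    rintro t ⟨φ, hφ, rfl⟩
    simpa [hψ] using norm_inner_sq_le hφ ψ
  obtain ⟨c, hc, hcz⟩ := exists_phase_sq (∑ i, ψ i ^ 2)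
  have h3 := reSq_add_imSq (c • ψ)
  have h4 := two_mul_imSq_eq (c • ψ)
  rw [sum_sq_smul, hcz, Complex.ofReal_re] at h4
  rw [norm_smul, hc, hψ] at h3 h4
  have hre : reSq (c • ψ) = (1 + ‖∑ i, ψ i ^ 2‖) / 2 := by linarith
  have hpos : 0 < ‖rePart (c • ψ)‖ := by
    have : 0 < ‖rePart (c • ψ)‖ ^ 2 := by rw [norm_rePart_sq, hre]; positivity
    exact norm_pos_iff.2 fun h => by simp [h] at this
  set φ : EuclideanSpace ℂ ι := ((‖rePart (c • ψ)‖⁻¹ : ℝ) : ℂ) • rePart (c • ψ) with hφdef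
  have hφ : IsRealPureState φ := by
    constructor
    · rw [hφdef, norm_smul, Complex.norm_real, norm_inv, norm_norm, inv_mul_cancel₀ hpos.ne']
    · intro i
      rw [hφdef]
      simp [rePart]
  have hin : ‖rePart (c • ψ)‖ ≤ ‖inner ℂ φ ψ‖ := by
    have h1 : (inner ℂ φ (c • ψ)).re = ‖rePart (c • ψ)‖ := by
      rw [inner_eq_sum_of_real hφ.2]
      have : ∀ i, (φ i).re * ((c • ψ) i).re =
          ‖rePart (c • ψ)‖⁻¹ * (((c • ψ) i).re) ^ 2 := by
        intro i
        rw [hφdef]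
        simp only [PiLp.smul_apply, smul_eq_mul, Complex.re_ofReal_mul, rePart,
          Complex.ofReal_re]
        ring
      rw [Finset.sum_congr rfl fun i _ => this i, ← Finset.mul_sum]
      change _ * reSq (c • ψ) = _
      rw [← norm_rePart_sq]
      field_simp
    rw [← h1]
    refine (Complex.re_le_norm _).trans ?_
    rw [inner_smul_right, norm_mul, hc, one_mul]
  have hsup : sSup {t : ℝ | ∃ φ : EuclideanSpace ℂ ι, IsRealPureState φ ∧
      t = ‖inner ℂ φ ψ‖ ^ 2} = (1 + ‖∑ i, ψ i ^ 2‖) / 2 := by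
    apply le_antisymm
    · exact csSup_le ⟨_, φ, hφ, rfl⟩ hle
    · refine le_trans ?_ (le_csSup ⟨_, hle⟩ ⟨φ, hφ, rfl⟩)
      rw [← hre, ← norm_rePart_sq]
      gcongr
  rw [pureImaginarity, hsup]; ring

theorem pureImaginarity_le_imSq {ψ : EuclideanSpace ℂ ι} (hψ : ‖ψ‖ = 1) :
    pureImaginarity ψ ≤ imSq ψ := by
  have h := two_mul_imSq_eq ψ
  rw [hψ] at h
  rw [pureImaginarity_eq hψ]
  linarith [Complex.re_le_norm (∑ i, ψ i ^ 2)]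

theorem pureImaginarity_nonneg {ψ : EuclideanSpace ℂ ι} (hψ : ‖ψ‖ = 1) :
    0 ≤ pureImaginarity ψ := by
  rw [pureImaginarity_eq hψ]
  have : ‖∑ i, ψ i ^ 2‖ ≤ 1 := by
    refine (norm_sum_le _ _).trans_eq ?_
    simp_rw [norm_pow]
    rw [← EuclideanSpace.norm_sq_eq, hψ, one_pow]
  linarith

theorem pureImaginarity_le_half {ψ : EuclideanSpace ℂ ι} (hψ : ‖ψ‖ = 1) :
    pureImaginarity ψ ≤ 1 / 2 := by
  rw [pureImaginarity_eq hψ]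
  linarith [norm_nonneg (∑ i, ψ i ^ 2)]

/-- Every unit vector is, up to a phase, one whose real and imaginary parts are orthogonal and
whose imaginary part realises its imaginarity. -/
theorem exists_phase_imSq_eq {ψ : EuclideanSpace ℂ ι} (hψ : ‖ψ‖ = 1) :
    ∃ c : ℂ, ‖c‖ = 1 ∧ imSq (c • ψ) = pureImaginarity ψ ∧ reIm (c • ψ) = 0 := by
  obtain ⟨c, hc, hcz⟩ := exists_phase_sq (∑ i, ψ i ^ 2)
  have h4 := two_mul_imSq_eq (c • ψ)
  have h5 := two_mul_reIm_eq (c • ψ)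
  rw [sum_sq_smul, hcz] at h4 h5
  rw [norm_smul, hc, hψ, Complex.ofReal_re] at h4
  rw [Complex.ofReal_im] at h5
  refine ⟨c, hc, ?_, by linarith⟩
  rw [pureImaginarity_eq hψ]; linarith

/-! ### Ensembles and optimal decompositions. -/

/-- A decomposition into unnormalised vectors can be normalised to an ensemble. -/
theorem exists_ensemble {α : Type*} [Fintype α] {ρ : Matrix κ κ ℂ} (hρ : ρ.trace = 1)
    {χ : α → EuclideanSpace ℂ κ} (h : ρ = ∑ k, ketbra (χ k)) :
    ∃ (r : ℕ) (p : Fin r → ℝ) (ψ : Fin r → EuclideanSpace ℂ κ),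
      IsEnsemble p ψ ρ ∧ ∑ j, p j * imSq (ψ j) = ∑ k, imSq (χ k) := by
  classical
  -- A zero vector is replaced by an arbitrary unit vector with weight `0`, so one must exist.
  have hne : Nonempty κ := by
    by_contra hc
    rw [not_nonempty_iff] at hc
    simp [Matrix.trace] at hρ
  obtain ⟨i₀⟩ := hne
  have hnorm : ∀ v : EuclideanSpace ℂ κ, ∃ u : EuclideanSpace ℂ κ, ‖u‖ = 1 ∧
      v = (‖v‖ : ℂ) • u := by
    intro v
    by_cases hv : v = 0
    · exact ⟨EuclideanSpace.single i₀ 1, by simp, by simp [hv]⟩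
    · have hv' : ‖v‖ ≠ 0 := norm_ne_zero_iff.2 hv
      refine ⟨((‖v‖⁻¹ : ℝ) : ℂ) • v, ?_, ?_⟩
      · rw [norm_smul, Complex.norm_real, norm_inv, norm_norm, inv_mul_cancel₀ hv']
      · rw [smul_smul, ← Complex.ofReal_mul, mul_inv_cancel₀ hv', Complex.ofReal_one, one_smul]
  choose u hu huv using hnorm
  let e := (Fintype.equivFin α).symm
  refine ⟨Fintype.card α, fun j => ‖χ (e j)‖ ^ 2, fun j => u (χ (e j)),
    ⟨fun j => sq_nonneg _, ?_, fun j => hu _, ?_⟩, ?_⟩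
  · rw [e.sum_comp fun k => ‖χ k‖ ^ 2]
    have h1 := congrArg Matrix.trace h
    rw [hρ, Matrix.trace_sum, Finset.sum_congr rfl fun k _ => trace_ketbra (χ k),
      ← Complex.ofReal_sum] at h1
    exact_mod_cast h1.symm
  · rw [e.sum_comp fun k => ((‖χ k‖ ^ 2 : ℝ) : ℂ) • ketbra (u (χ k)), h]
    refine Finset.sum_congr rfl fun k _ => ?_
    conv_lhs => rw [huv (χ k), ketbra_smul, Complex.norm_real, norm_norm]
  · rw [e.sum_comp fun k => ‖χ k‖ ^ 2 * imSq (u (χ k))]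
    refine Finset.sum_congr rfl fun k _ => ?_
    conv_rhs => rw [huv (χ k), imSq_real_smul]

theorem bddBelow_imaginarity (ρ : Matrix κ κ ℂ) :
    BddBelow {s : ℝ | ∃ (r : ℕ) (p : Fin r → ℝ) (ψ : Fin r → EuclideanSpace ℂ κ),
      IsEnsemble p ψ ρ ∧ s = ∑ j, p j * pureImaginarity (ψ j)} := by
  refine ⟨0, ?_⟩
  rintro s ⟨r, p, ψ, h, rfl⟩
  exact Finset.sum_nonneg fun j _ =>
    mul_nonneg (h.nonneg j) (pureImaginarity_nonneg (h.norm_eq_one j))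

theorem imaginarity_nonneg (ρ : Matrix κ κ ℂ) : 0 ≤ imaginarity ρ := by
  refine Real.sInf_nonneg ?_
  rintro s ⟨r, p, ψ, h, rfl⟩
  exact Finset.sum_nonneg fun j _ =>
    mul_nonneg (h.nonneg j) (pureImaginarity_nonneg (h.norm_eq_one j))

theorem IsEnsemble.imaginarity_le {r : ℕ} {p : Fin r → ℝ} {ψ : Fin r → EuclideanSpace ℂ κ}
    {ρ : Matrix κ κ ℂ} (h : IsEnsemble p ψ ρ) :
    imaginarity ρ ≤ ∑ j, p j * pureImaginarity (ψ j) :=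
  csInf_le (bddBelow_imaginarity ρ) ⟨r, p, ψ, h, rfl⟩

theorem imaginarity_le_sum_imSq {α : Type*} [Fintype α] {ρ : Matrix κ κ ℂ} (hρ : ρ.trace = 1)
    {χ : α → EuclideanSpace ℂ κ} (h : ρ = ∑ k, ketbra (χ k)) :
    imaginarity ρ ≤ ∑ k, imSq (χ k) := by
  obtain ⟨r, p, ψ, he, hs⟩ := exists_ensemble hρ h
  rw [← hs]
  exact he.imaginarity_le.trans <| Finset.sum_le_sum fun j _ =>
    mul_le_mul_of_nonneg_left (pureImaginarity_le_imSq (he.norm_eq_one j)) (he.nonneg j)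

/-- The states paired with the imaginary weight of a representing vector. -/
def weightedStates (κ : Type*) [Fintype κ] : Set (Matrix κ κ ℂ × ℝ) :=
  (fun ψ : EuclideanSpace ℂ κ => (ketbra ψ, imSq ψ)) '' Metric.sphere 0 1

theorem isCompact_weightedStates : IsCompact (weightedStates κ) :=
  (isCompact_sphere _ _).image (continuous_ketbra.prodMk continuous_imSq)

theorem IsEnsemble.mem_convexHull {r : ℕ} {p : Fin r → ℝ} {ψ : Fin r → EuclideanSpace ℂ κ}
    {ρ : Matrix κ κ ℂ} (h : IsEnsemble p ψ ρ) :
    (ρ, ∑ j, p j * imSq (ψ j)) ∈ convexHull ℝ (weightedStates κ) := by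
  refine mem_convexHull_of_exists_fintype p (fun j => (ketbra (ψ j), imSq (ψ j)))
    h.nonneg h.sum_eq_one (fun j => ⟨ψ j, by simp [h.norm_eq_one j], rfl⟩) ?_
  refine Prod.ext ?_ ?_
  · rw [Prod.fst_sum, h.decomposition]; rfl
  · rw [Prod.snd_sum]; rfl

/-- A phase-adjusted ensemble has imaginary weight equal to its average imaginarity. -/
theorem IsEnsemble.exists_adjusted {r : ℕ} {p : Fin r → ℝ} {ψ : Fin r → EuclideanSpace ℂ κ}
    {ρ : Matrix κ κ ℂ} (h : IsEnsemble p ψ ρ) :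
    ∃ φ : Fin r → EuclideanSpace ℂ κ, IsEnsemble p φ ρ ∧
      (∀ j, imSq (φ j) = pureImaginarity (ψ j)) ∧ ∀ j, reIm (φ j) = 0 := by
  choose c hc him hri using fun j => exists_phase_imSq_eq (h.norm_eq_one j)
  refine ⟨fun j => c j • ψ j, ⟨h.nonneg, h.sum_eq_one, fun j => ?_, ?_⟩, him, hri⟩
  · rw [norm_smul, hc, h.norm_eq_one, one_mul]
  · simp_rw [ketbra_smul_of_norm_eq_one (hc _)]
    exact h.decomposition

/-- The imaginarity of a density matrix is attained, by vectors with orthogonal real and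
imaginary parts. -/
theorem exists_optimal_decomposition {ρ : Matrix κ κ ℂ} (hρ : IsDensityMatrix ρ) :
    ∃ (r : ℕ) (χ : Fin r → EuclideanSpace ℂ κ), ρ = ∑ j, ketbra (χ j) ∧
      ∑ j, imSq (χ j) = imaginarity ρ ∧ ∑ j, reSq (χ j) = 1 - imaginarity ρ ∧
      ∑ j, reIm (χ j) = 0 := by
  -- Ensembles have unbounded length; the fibre of the hull over `ρ` is compact and encodes all of
  -- them, so the weight has a minimum there.
  have hcpt : IsCompact (convexHull ℝ (weightedStates κ) ∩ {q | q.1 = ρ}) :=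
    (isCompact_convexHull_of_isCompact isCompact_weightedStates).inter_right
      (isClosed_eq continuous_fst continuous_const)
  have hne : (convexHull ℝ (weightedStates κ) ∩ {q | q.1 = ρ}).Nonempty := by
    obtain ⟨r, z, hz⟩ := exists_eq_sum_ketbra hρ.1
    obtain ⟨r', p, ψ, he, -⟩ := exists_ensemble hρ.2 hz
    exact ⟨_, he.mem_convexHull, rfl⟩
  obtain ⟨⟨ρ', s⟩, ⟨hmem, rfl⟩, hmin⟩ := hcpt.exists_isMinOn hne continuous_snd.continuousOn
  obtain ⟨α, _, w, z, hw, hw1, hz, hsum⟩ := mem_convexHull_iff_exists_fintype.1 hmem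
  choose v hv hvz using hz
  have hcomp : ∑ k, w k • ketbra (v k) = ρ' ∧ ∑ k, w k * imSq (v k) = s := by
    have h1 := congrArg Prod.fst hsum
    have h2 := congrArg Prod.snd hsum
    rw [Prod.fst_sum] at h1
    rw [Prod.snd_sum] at h2
    simp only [← hvz] at h1 h2
    exact ⟨h1, h2⟩
  have hdec : ρ' = ∑ k, ketbra (((√(w k) : ℝ) : ℂ) • v k) := by
    rw [← hcomp.1]
    refine Finset.sum_congr rfl fun k _ => ?_
    rw [ketbra_smul, Complex.norm_real, Real.norm_eq_abs, sq_abs, Real.sq_sqrt (hw k)]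
    rfl
  obtain ⟨r, p, ψ, he, hps⟩ := exists_ensemble hρ.2 hdec
  have hs : ∑ j, p j * imSq (ψ j) = s := by
    rw [hps, ← hcomp.2]
    exact Finset.sum_congr rfl fun k _ => by rw [imSq_real_smul, Real.sq_sqrt (hw k)]
  have hlow : s ≤ imaginarity ρ' := by
    refine le_csInf ⟨_, r, p, ψ, he, rfl⟩ ?_
    rintro _ ⟨r', p', ψ', he', rfl⟩
    obtain ⟨φ, hφ, him, -⟩ := he'.exists_adjusted
    have : s ≤ ∑ j, p' j * imSq (φ j) := hmin (show (ρ', ∑ j, p' j * imSq (φ j)) ∈ _ from ⟨hφ.mem_convexHull, rfl⟩)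
    simpa only [him] using this
  obtain ⟨φ, hφ, him, hri⟩ := he.exists_adjusted
  -- Adjusting phases cannot raise the weight, which was already minimal, so `s` is squeezed to
  -- `imaginarity ρ'`.
  have hup : ∑ j, p j * imSq (φ j) ≤ s := by
    rw [← hs]
    refine Finset.sum_le_sum fun j _ => mul_le_mul_of_nonneg_left ?_ (he.nonneg j)
    rw [him]
    exact pureImaginarity_le_imSq (he.norm_eq_one j)
  have heq : ∑ j, p j * imSq (φ j) = imaginarity ρ' := by
    refine le_antisymm (hup.trans hlow) ?_
    simp only [him]
    exact he.imaginarity_le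
  refine ⟨r, fun j => ((√(p j) : ℝ) : ℂ) • φ j, ?_, ?_, ?_, ?_⟩
  · rw [hφ.decomposition]
    refine Finset.sum_congr rfl fun k _ => ?_
    rw [ketbra_smul, Complex.norm_real, Real.norm_eq_abs, sq_abs, Real.sq_sqrt (hφ.nonneg k)]
  · rw [← heq]
    exact Finset.sum_congr rfl fun k _ => by rw [imSq_real_smul, Real.sq_sqrt (hφ.nonneg k)]
  · rw [← heq, ← hφ.sum_eq_one, ← Finset.sum_sub_distrib]
    refine Finset.sum_congr rfl fun k _ => ?_
    rw [reSq_real_smul, Real.sq_sqrt (hφ.nonneg k)]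
    have := reSq_add_imSq (φ k)
    rw [hφ.norm_eq_one] at this
    linear_combination p k * this
  · simp only [reIm_real_smul, hri, mul_zero, Finset.sum_const_zero]

/-! ### Monotonicity: the upper bound. -/

/-- Real operations contract real vectors on average. -/
theorem sum_norm_sq_mulVec_le {Λ : Matrix ι ι ℂ →ₗ[ℂ] Matrix κ κ ℂ} {r : ℕ}
    {K : Fin r → Matrix κ ι ℂ} (hK : ∀ X, Λ X = ∑ m, K m * X * (K m).conjTranspose)
    (hΛ : ∀ X : Matrix ι ι ℂ, X.PosSemidef → (Λ X).trace.re ≤ X.trace.re)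
    (v : EuclideanSpace ℂ ι) :
    ∑ m, ‖(WithLp.toLp 2 ((K m).mulVec v) : EuclideanSpace ℂ κ)‖ ^ 2 ≤ ‖v‖ ^ 2 := by
  have h := hΛ (ketbra v) (posSemidef_ketbra v)
  simp only [hK, mul_ketbra_mul_conjTranspose, Matrix.trace_sum, trace_ketbra] at h
  rw [← Complex.ofReal_sum, Complex.ofReal_re, Complex.ofReal_re] at h
  exact h

/-- The componentwise imaginary part of a vector. -/
noncomputable def imPart (ψ : EuclideanSpace ℂ ι) : EuclideanSpace ℂ ι :=
  WithLp.toLp 2 fun i => ((ψ i).im : ℂ)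

theorem norm_imPart_sq (ψ : EuclideanSpace ℂ ι) : ‖imPart ψ‖ ^ 2 = imSq ψ := by
  rw [← reSq_add_imSq]; simp [reSq, imSq, imPart]

theorem imSq_mulVec_of_real {K : Matrix κ ι ℂ} (hK : ∀ i j, (K i j).im = 0)
    (ψ : EuclideanSpace ℂ ι) :
    imSq (WithLp.toLp 2 (K.mulVec ψ) : EuclideanSpace ℂ κ) =
      ‖(WithLp.toLp 2 (K.mulVec (imPart ψ)) : EuclideanSpace ℂ κ)‖ ^ 2 := by
  rw [← reSq_add_imSq]
  simp [imSq, reSq, Matrix.mulVec, dotProduct, imPart, hK]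

/-- Imaginarity does not increase on average under real operations. -/
theorem mul_imaginarity_le {ψ : EuclideanSpace ℂ ι} (hψ : ‖ψ‖ = 1) {ρ : Matrix κ κ ℂ}
    (hρ : ρ.trace = 1) {p : ℝ} (hp : p ∈ transformationProbabilities (ketbra ψ) ρ)
    (hp0 : 0 < p) : p * imaginarity ρ ≤ pureImaginarity ψ := by
  obtain ⟨Λ, ⟨⟨r, K, hKre, hK⟩, hΛ⟩, -, hout⟩ := hp
  -- The input projector ignores phases, so the representative whose imaginary weight is exactly
  -- `pureImaginarity ψ` may be used.
  obtain ⟨c, hc, him, -⟩ := exists_phase_imSq_eq hψ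
  rw [← ketbra_smul_of_norm_eq_one hc, hK] at hout
  simp only [mul_ketbra_mul_conjTranspose] at hout
  have hs : (√p)⁻¹ ^ 2 = p⁻¹ := by rw [inv_pow, Real.sq_sqrt hp0.le]
  have hdec : ρ = ∑ m, ketbra ((((√p)⁻¹ : ℝ) : ℂ) •
      (WithLp.toLp 2 ((K m).mulVec (c • ψ)) : EuclideanSpace ℂ κ)) := by
    simp only [ketbra_smul]
    rw [← Finset.smul_sum]
    rw [Complex.norm_real, Real.norm_eq_abs, sq_abs, hs]
    have := congrArg (fun X => ((p⁻¹ : ℝ) : ℂ) • X) hout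
    simp only [smul_smul, ← Complex.ofReal_mul, inv_mul_cancel₀ hp0.ne', Complex.ofReal_one,
      one_smul] at this
    exact this.symm
  have h1 := imaginarity_le_sum_imSq hρ hdec
  simp only [imSq_real_smul, hs, ← Finset.mul_sum] at h1
  simp only [imSq_mulVec_of_real (hKre _)] at h1
  have h2 := sum_norm_sq_mulVec_le hK hΛ (imPart (c • ψ))
  rw [norm_imPart_sq, him] at h2
  rw [inv_mul_eq_div, le_div_iff₀ hp0] at h1
  rw [mul_comm]
  exact h1.trans h2

theorem le_one_of_mem_transformationProbabilities {ψ : EuclideanSpace ℂ ι} (hψ : ‖ψ‖ = 1)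
    {ρ : Matrix κ κ ℂ} {p : ℝ} (hp : p ∈ transformationProbabilities (ketbra ψ) ρ) :
    p ≤ 1 := by
  obtain ⟨Λ, hΛ, htr, -⟩ := hp
  simpa [htr, trace_ketbra, hψ] using hΛ.2 _ (posSemidef_ketbra ψ)

/-! ### Transfer operators. -/

/-- Bessel's inequality for two orthogonal real vectors, not assumed nonzero. -/
theorem bessel_two {a b : ι → ℝ} (hab : ∑ i, a i * b i = 0) (u : ι → ℝ) :
    (∑ i, a i ^ 2) * ((∑ i, a i * u i) / ∑ i, a i ^ 2) ^ 2 +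
      (∑ i, b i ^ 2) * ((∑ i, b i * u i) / ∑ i, b i ^ 2) ^ 2 ≤ ∑ i, u i ^ 2 := by
  -- For `a = 0` both sides vanish, so the convention `x / 0 = 0` does no harm.
  have hz : ∀ a : ι → ℝ, (∑ i, a i * u i) / (∑ i, a i ^ 2) * (∑ i, a i ^ 2) =
      ∑ i, a i * u i := by
    intro a
    apply div_mul_cancel_of_imp
    intro h
    rw [Finset.sum_eq_zero_iff_of_nonneg fun i _ => sq_nonneg _] at h
    exact Finset.sum_eq_zero fun i hi => by rw [pow_eq_zero_iff two_ne_zero |>.1 (h i hi), zero_mul]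
  have ha := hz a
  have hb := hz b
  set α := (∑ i, a i * u i) / ∑ i, a i ^ 2
  set γ := (∑ i, b i * u i) / ∑ i, b i ^ 2
  have h0 : 0 ≤ ∑ i, (u i - α * a i - γ * b i) ^ 2 := Finset.sum_nonneg fun _ _ => sq_nonneg _
  have hexp : ∑ i, (u i - α * a i - γ * b i) ^ 2 = ∑ i, u i ^ 2 + α ^ 2 * ∑ i, a i ^ 2
      + γ ^ 2 * ∑ i, b i ^ 2 - 2 * α * ∑ i, a i * u i - 2 * γ * ∑ i, b i * u i
      + 2 * α * γ * ∑ i, a i * b i := by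
    simp only [Finset.mul_sum, ← Finset.sum_add_distrib, ← Finset.sum_sub_distrib]
    exact Finset.sum_congr rfl fun i _ => by ring
  rw [hexp, hab, ← ha, ← hb] at h0
  linarith

/-- The real Kraus operator sending the real and imaginary parts of `ψ` to those of `χ`. -/
noncomputable def transferKraus {κ : Type*} (ψ : EuclideanSpace ℂ ι) (χ : EuclideanSpace ℂ κ) :
    Matrix κ ι ℂ :=
  Matrix.of fun i j => (((χ i).re * ((ψ j).re / reSq ψ) + (χ i).im * ((ψ j).im / imSq ψ) : ℝ) : ℂ)

theorem transferKraus_mulVec {κ : Type*} (ψ : EuclideanSpace ℂ ι) (χ : EuclideanSpace ℂ κ)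
    (z : EuclideanSpace ℂ ι) (i : κ) :
    ((transferKraus ψ χ).mulVec z i).re =
        (χ i).re * ((∑ j, (ψ j).re * (z j).re) / reSq ψ) +
        (χ i).im * ((∑ j, (ψ j).im * (z j).re) / imSq ψ) ∧
      ((transferKraus ψ χ).mulVec z i).im =
        (χ i).re * ((∑ j, (ψ j).re * (z j).im) / reSq ψ) +
        (χ i).im * ((∑ j, (ψ j).im * (z j).im) / imSq ψ) := by
  simp only [Matrix.mulVec, dotProduct, transferKraus, Matrix.of_apply, Complex.re_sum,
    Complex.im_sum, Complex.re_ofReal_mul, Complex.im_ofReal_mul, Finset.sum_div,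
    Finset.mul_sum, ← Finset.sum_add_distrib]
  constructor <;> exact Finset.sum_congr rfl fun j _ => by ring

/-- Orthogonality removes the mixed terms. If a part of `ψ` is zero, its quotient in the operator is
`0`, so the matching part of `χ` must vanish too. -/
theorem transferKraus_mulVec_self {ψ : EuclideanSpace ℂ ι} (hψ : reIm ψ = 0)
    {χ : EuclideanSpace ℂ κ} (hre : reSq ψ = 0 → reSq χ = 0) (him : imSq ψ = 0 → imSq χ = 0) :
    (WithLp.toLp 2 ((transferKraus ψ χ).mulVec ψ) : EuclideanSpace ℂ κ) = χ := by
  have h1 : ∑ j, (ψ j).re * (ψ j).re = reSq ψ := Finset.sum_congr rfl fun _ _ => (sq _).symm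
  have h2 : ∑ j, (ψ j).im * (ψ j).im = imSq ψ := Finset.sum_congr rfl fun _ _ => (sq _).symm
  have h3 : ∑ j, (ψ j).re * (ψ j).im = 0 := hψ
  have h4 : ∑ j, (ψ j).im * (ψ j).re = 0 := by simpa only [mul_comm] using h3
  ext i
  obtain ⟨hr, hi⟩ := transferKraus_mulVec ψ χ ψ i
  rw [h1, h4, zero_div, mul_zero, add_zero] at hr
  rw [h2, h3, zero_div, mul_zero, zero_add] at hi
  apply Complex.ext
  · refine hr.trans ?_
    by_cases h : reSq ψ = 0
    · have h' := hre h
      rw [reSq, Finset.sum_eq_zero_iff_of_nonneg fun i _ => sq_nonneg _] at h'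
      rw [pow_eq_zero_iff two_ne_zero |>.1 (h' i (Finset.mem_univ i)), zero_mul]
    · rw [div_self h, mul_one]
  · refine hi.trans ?_
    by_cases h : imSq ψ = 0
    · have h' := him h
      rw [imSq, Finset.sum_eq_zero_iff_of_nonneg fun i _ => sq_nonneg _] at h'
      rw [pow_eq_zero_iff two_ne_zero |>.1 (h' i (Finset.mem_univ i)), zero_mul]
    · rw [div_self h, mul_one]

/-- The transfer Kraus operators of a small enough family contract every vector on average. -/
theorem sum_norm_sq_transferKraus_le {α : Type*} [Fintype α] {ψ : EuclideanSpace ℂ ι}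
    (hψ : reIm ψ = 0) {χ : α → EuclideanSpace ℂ κ} (hre : ∑ k, reSq (χ k) ≤ reSq ψ)
    (him : ∑ k, imSq (χ k) ≤ imSq ψ) (hri : ∑ k, reIm (χ k) = 0) (z : EuclideanSpace ℂ ι) :
    ∑ k, ‖(WithLp.toLp 2 ((transferKraus ψ (χ k)).mulVec z) : EuclideanSpace ℂ κ)‖ ^ 2 ≤
      ‖z‖ ^ 2 := by
  -- Here `s`, `t` stand for the coefficients along `Re ψ`, `Im ψ` of the real part of `z`, then of
  -- its imaginary part; Bessel bounds the right-hand side.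
  have hsum : ∀ s t : ℝ, ∑ k, ∑ i, ((χ k i).re * s + (χ k i).im * t) ^ 2 ≤
      reSq ψ * s ^ 2 + imSq ψ * t ^ 2 := by
    intro s t
    have : ∑ k, ∑ i, ((χ k i).re * s + (χ k i).im * t) ^ 2 =
        (∑ k, reSq (χ k)) * s ^ 2 + (∑ k, imSq (χ k)) * t ^ 2 +
          2 * s * t * ∑ k, reIm (χ k) := by
      simp only [reSq, imSq, reIm, Finset.mul_sum, Finset.sum_mul, ← Finset.sum_add_distrib]
      exact Finset.sum_congr rfl fun k _ => Finset.sum_congr rfl fun i _ => by ring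
    rw [this, hri, mul_zero, add_zero]
    gcongr
  have hb1 := bessel_two (a := fun i => (ψ i).re) (b := fun i => (ψ i).im) hψ fun i => (z i).re
  have hb2 := bessel_two (a := fun i => (ψ i).re) (b := fun i => (ψ i).im) hψ fun i => (z i).im
  rw [← reSq_add_imSq z]
  simp only [← reSq_add_imSq (WithLp.toLp 2 _ : EuclideanSpace ℂ κ), Finset.sum_add_distrib]
  refine add_le_add ?_ ?_
  · refine le_trans (le_of_eq ?_) ((hsum _ _).trans hb1)
    exact Finset.sum_congr rfl fun k _ => Finset.sum_congr rfl fun i _ =>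
      congrArg (· ^ 2) (transferKraus_mulVec ψ (χ k) z i).1
  · refine le_trans (le_of_eq ?_) ((hsum _ _).trans hb2)
    exact Finset.sum_congr rfl fun k _ => Finset.sum_congr rfl fun i _ =>
      congrArg (· ^ 2) (transferKraus_mulVec ψ (χ k) z i).2

/-- The linear map with Kraus operators `K`. -/
def krausMap {κ : Type*} {r : ℕ} (K : Fin r → Matrix κ ι ℂ) : Matrix ι ι ℂ →ₗ[ℂ] Matrix κ κ ℂ where
  toFun X := ∑ m, K m * X * (K m).conjTranspose
  map_add' X Y := by simp only [Matrix.mul_add, Matrix.add_mul, Finset.sum_add_distrib]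
  map_smul' c X := by simp only [Matrix.mul_smul, Matrix.smul_mul, Finset.smul_sum, RingHom.id_apply]

theorem krausMap_ketbra {κ : Type*} {r : ℕ} (K : Fin r → Matrix κ ι ℂ) (z : EuclideanSpace ℂ ι) :
    krausMap K (ketbra z) = ∑ m, ketbra (WithLp.toLp 2 ((K m).mulVec z)) := by
  change ∑ m, K m * ketbra z * (K m).conjTranspose = _
  simp only [mul_ketbra_mul_conjTranspose]

/-- A contractive family of real Kraus operators defines a real operation. -/
theorem isRealOperation_krausMap {r : ℕ} {K : Fin r → Matrix κ ι ℂ}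
    (hK : ∀ m i j, (K m i j).im = 0)
    (hle : ∀ z : EuclideanSpace ℂ ι,
      ∑ m, ‖(WithLp.toLp 2 ((K m).mulVec z) : EuclideanSpace ℂ κ)‖ ^ 2 ≤ ‖z‖ ^ 2) :
    IsRealOperation (krausMap K) := by
  refine ⟨⟨r, K, hK, fun X => rfl⟩, fun X hX => ?_⟩
  obtain ⟨s, z, rfl⟩ := exists_eq_sum_ketbra hX
  rw [map_sum, Matrix.trace_sum, Matrix.trace_sum, Complex.re_sum, Complex.re_sum]
  refine Finset.sum_le_sum fun k _ => ?_
  rw [krausMap_ketbra, Matrix.trace_sum, trace_ketbra,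
    Finset.sum_congr rfl fun m _ => trace_ketbra _, ← Complex.ofReal_sum,
    Complex.ofReal_re, Complex.ofReal_re]
  exact hle (z k)

/-- A family of target vectors dominated by `ψ` can be produced from `ψ` by a real operation. -/
theorem exists_isRealOperation {α : Type*} [Fintype α] {ψ : EuclideanSpace ℂ ι}
    (hψ : reIm ψ = 0) {χ : α → EuclideanSpace ℂ κ} (hre : ∑ k, reSq (χ k) ≤ reSq ψ)
    (him : ∑ k, imSq (χ k) ≤ imSq ψ) (hri : ∑ k, reIm (χ k) = 0) :
    ∃ Λ : Matrix ι ι ℂ →ₗ[ℂ] Matrix κ κ ℂ, IsRealOperation Λ ∧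
      Λ (ketbra ψ) = ∑ k, ketbra (χ k) := by
  let e := (Fintype.equivFin α).symm
  refine ⟨krausMap fun m => transferKraus ψ (χ (e m)), isRealOperation_krausMap ?_ ?_, ?_⟩
  · exact fun m i j => Complex.ofReal_im _
  · intro z
    rw [e.sum_comp fun k =>
      ‖(WithLp.toLp 2 ((transferKraus ψ (χ k)).mulVec z) : EuclideanSpace ℂ κ)‖ ^ 2]
    exact sum_norm_sq_transferKraus_le hψ hre him hri z
  · rw [krausMap_ketbra, ← e.sum_comp fun k => ketbra (χ k)]
    refine Finset.sum_congr rfl fun m _ => ?_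
    rw [transferKraus_mulVec_self hψ]
    · intro h
      exact le_antisymm ((Finset.single_le_sum (fun k _ => reSq_nonneg (χ k))
        (Finset.mem_univ (e m))).trans (hre.trans h.le)) (reSq_nonneg _)
    · intro h
      exact le_antisymm ((Finset.single_le_sum (fun k _ => imSq_nonneg (χ k))
        (Finset.mem_univ (e m))).trans (him.trans h.le)) (imSq_nonneg _)

/-! ### Attaining the optimal probability. -/

/-- Rotating by a phase and by its inverse mixes real and imaginary weights and cancels the
cross terms. -/
theorem rotation_pair (c s : ℝ) (χ : EuclideanSpace ℂ κ) :
    reSq ((⟨c, s⟩ : ℂ) • χ) + reSq ((⟨c, -s⟩ : ℂ) • χ) =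
        2 * (c ^ 2 * reSq χ + s ^ 2 * imSq χ) ∧
      imSq ((⟨c, s⟩ : ℂ) • χ) + imSq ((⟨c, -s⟩ : ℂ) • χ) =
        2 * (c ^ 2 * imSq χ + s ^ 2 * reSq χ) ∧
      reIm ((⟨c, s⟩ : ℂ) • χ) + reIm ((⟨c, -s⟩ : ℂ) • χ) =
        2 * (c ^ 2 - s ^ 2) * reIm χ := by
  simp only [reSq, imSq, reIm, PiLp.smul_apply, smul_eq_mul, Complex.mul_re, Complex.mul_im,
    Finset.mul_sum, ← Finset.sum_add_distrib]
  refine ⟨?_, ?_, ?_⟩ <;> exact Finset.sum_congr rfl fun i _ => by ring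

/-- Probabilities reachable by mixing an optimal decomposition with its phase rotations. -/
theorem mem_transformationProbabilities {ψ : EuclideanSpace ℂ ι} (hψ : ‖ψ‖ = 1)
    {ρ : Matrix κ κ ℂ} (hρ : IsDensityMatrix ρ) {p t : ℝ} (hp : 0 ≤ p) (ht : 0 ≤ t) (ht1 : t ≤ 1)
    (him : p * ((1 - t) * imaginarity ρ + t * (1 - imaginarity ρ)) ≤ pureImaginarity ψ)
    (hre : p * ((1 - t) * (1 - imaginarity ρ) + t * imaginarity ρ) ≤ 1 - pureImaginarity ψ) :
    p ∈ transformationProbabilities (ketbra ψ) ρ := by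
  obtain ⟨d, hd, hdim, hdri⟩ := exists_phase_imSq_eq hψ
  have hdre : reSq (d • ψ) = 1 - pureImaginarity ψ := by
    have := reSq_add_imSq (d • ψ)
    rw [norm_smul, hd, hψ, hdim] at this
    linarith
  obtain ⟨r, χ, hdec, hχim, hχre, hχri⟩ := exists_optimal_decomposition hρ
  set c := √(1 - t)
  set s := √t
  have hc : c ^ 2 = 1 - t := Real.sq_sqrt (by linarith)
  have hs : s ^ 2 = t := Real.sq_sqrt ht
  set q := √(p / 2)
  have hq : q ^ 2 = p / 2 := Real.sq_sqrt (by positivity)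
  have hn : ∀ x y : ℝ, x ^ 2 + y ^ 2 = 1 → ‖(⟨x, y⟩ : ℂ)‖ = 1 := by
    intro x y h
    rw [Complex.norm_eq_sqrt_sq_add_sq, h, Real.sqrt_one]
  have hu : ‖(⟨c, s⟩ : ℂ)‖ = 1 := hn c s (by rw [hc, hs]; ring)
  have hu' : ‖(⟨c, -s⟩ : ℂ)‖ = 1 := hn c (-s) (by rw [neg_sq, hc, hs]; ring)
  -- Each `χ k` is rotated by `±θ` with `sin² θ = t`, each copy carrying weight `p / 2`: a fraction
  -- `t` of the real and imaginary weights is swapped, while the projectors still sum to `p ρ`.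
  let ξ : Fin r ⊕ Fin r → EuclideanSpace ℂ κ := Sum.elim
    (fun k => (q : ℂ) • (⟨c, s⟩ : ℂ) • χ k) (fun k => (q : ℂ) • (⟨c, -s⟩ : ℂ) • χ k)
  have h1 : ∑ k, reSq (ξ k) = p * ((1 - t) * (1 - imaginarity ρ) + t * imaginarity ρ) := by
    simp only [ξ, Fintype.sum_sum_type, Sum.elim_inl, Sum.elim_inr, reSq_real_smul,
      ← Finset.sum_add_distrib, ← mul_add, (rotation_pair c s _).1]
    simp only [← Finset.mul_sum, Finset.sum_add_distrib, hχim, hχre, hc, hs, hq]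
    ring
  have h2 : ∑ k, imSq (ξ k) = p * ((1 - t) * imaginarity ρ + t * (1 - imaginarity ρ)) := by
    simp only [ξ, Fintype.sum_sum_type, Sum.elim_inl, Sum.elim_inr, imSq_real_smul,
      ← Finset.sum_add_distrib, ← mul_add, (rotation_pair c s _).2.1]
    simp only [← Finset.mul_sum, Finset.sum_add_distrib, hχim, hχre, hc, hs, hq]
    ring
  have h3 : ∑ k, reIm (ξ k) = 0 := by
    simp only [ξ, Fintype.sum_sum_type, Sum.elim_inl, Sum.elim_inr, reIm_real_smul,
      ← Finset.sum_add_distrib, ← mul_add, (rotation_pair c s _).2.2]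
    simp only [← Finset.mul_sum, hχri, mul_zero]
  have h4 : ∑ k, ketbra (ξ k) = (p : ℂ) • ρ := by
    simp only [ξ, Fintype.sum_sum_type, Sum.elim_inl, Sum.elim_inr, ketbra_smul (q : ℂ),
      ketbra_smul_of_norm_eq_one hu, ketbra_smul_of_norm_eq_one hu']
    rw [← Finset.smul_sum, ← hdec, ← add_smul, Complex.norm_real, Real.norm_eq_abs, sq_abs, hq,
      ← Complex.ofReal_add, add_halves]
  obtain ⟨Λ, hΛ, hout⟩ := exists_isRealOperation hdri (h1.trans_le (hre.trans_eq hdre.symm))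
    (h2.trans_le (him.trans_eq hdim.symm)) h3
  rw [ketbra_smul_of_norm_eq_one hd, h4] at hout
  refine ⟨Λ, hΛ, ?_, hout⟩
  rw [hout, Matrix.trace_smul, hρ.2, smul_eq_mul, mul_one]

theorem one_mem_transformationProbabilities {ψ : EuclideanSpace ℂ ι} (hψ : ‖ψ‖ = 1)
    {ρ : Matrix κ κ ℂ} (hρ : IsDensityMatrix ρ) (h : imaginarity ρ ≤ pureImaginarity ψ) :
    1 ∈ transformationProbabilities (ketbra ψ) ρ := by
  have hhalf := pureImaginarity_le_half hψ
  -- Equality is separate because `1 - 2 * imaginarity ρ` may then be zero; no rotation is needed.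
  rcases h.eq_or_lt with h | h
  · exact mem_transformationProbabilities hψ hρ zero_le_one le_rfl zero_le_one
      (by linarith) (by linarith)
  · have hpos : 0 < 1 - 2 * imaginarity ρ := by linarith
    have ht : (pureImaginarity ψ - imaginarity ρ) / (1 - 2 * imaginarity ρ) *
        (1 - 2 * imaginarity ρ) = pureImaginarity ψ - imaginarity ρ :=
      div_mul_cancel₀ _ hpos.ne'
    -- This `t` solves `(1 - t) I(ρ) + t (1 - I(ρ)) = I(ψ)`; it is at most `1` since both
    -- imaginarities are at most `1 / 2`.
    refine mem_transformationProbabilities hψ hρ zero_le_one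
      (t := (pureImaginarity ψ - imaginarity ρ) / (1 - 2 * imaginarity ρ))
      (div_nonneg (by linarith) hpos.le) ?_ (by linarith) (by linarith)
    rw [div_le_one hpos]
    linarith

/-- Without rotation (`t = 0`) the imaginary constraint is tight, and the real one reduces to `p ≤
1`. -/
theorem div_mem_transformationProbabilities {ψ : EuclideanSpace ℂ ι} (hψ : ‖ψ‖ = 1)
    {ρ : Matrix κ κ ℂ} (hρ : IsDensityMatrix ρ) (h : pureImaginarity ψ < imaginarity ρ) :
    pureImaginarity ψ / imaginarity ρ ∈ transformationProbabilities (ketbra ψ) ρ := by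
  have hψ0 := pureImaginarity_nonneg hψ
  have hpos : 0 < imaginarity ρ := hψ0.trans_lt h
  have hcancel : pureImaginarity ψ / imaginarity ρ * imaginarity ρ = pureImaginarity ψ :=
    div_mul_cancel₀ _ hpos.ne'
  have hle : pureImaginarity ψ / imaginarity ρ ≤ 1 := (div_le_one hpos).2 h.le
  exact mem_transformationProbabilities hψ hρ (div_nonneg hψ0 hpos.le) le_rfl zero_le_one
    (by linarith) (by linarith)

end RealQuantum

/-! ### The main theorem. -/

theorem mainTheorem2 {ι κ : Type*} [Fintype ι] [Fintype κ]
    (ψ : EuclideanSpace ℂ ι) (hψ : ‖ψ‖ = 1)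
    (ρ : Matrix κ κ ℂ) (hρ : RealQuantum.IsDensityMatrix ρ) :
    IsGreatest (RealQuantum.transformationProbabilities (RealQuantum.ketbra ψ) ρ)
      (if RealQuantum.imaginarity ρ = 0 then 1
        else min (RealQuantum.pureImaginarity ψ / RealQuantum.imaginarity ρ) 1) := by
  have hψ0 := RealQuantum.pureImaginarity_nonneg hψ
  have hρ0 := RealQuantum.imaginarity_nonneg ρ
  constructor
  · split_ifs with h0
    · exact RealQuantum.one_mem_transformationProbabilities hψ hρ (h0.trans_le hψ0)
    · have hpos := lt_of_le_of_ne hρ0 (Ne.symm h0)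
      rcases le_or_gt (RealQuantum.imaginarity ρ) (RealQuantum.pureImaginarity ψ) with h | h
      · rw [min_eq_right ((one_le_div hpos).2 h)]
        exact RealQuantum.one_mem_transformationProbabilities hψ hρ h
      · rw [min_eq_left ((div_le_one hpos).2 h.le)]
        exact RealQuantum.div_mem_transformationProbabilities hψ hρ h
  · intro p hp
    have h1 := RealQuantum.le_one_of_mem_transformationProbabilities hψ hp
    split_ifs with h0
    · exact h1
    · have hpos := lt_of_le_of_ne hρ0 (Ne.symm h0)
      refine le_min ?_ h1
      rcases le_or_gt p 0 with hp0 | hp0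
      · exact hp0.trans (div_nonneg hψ0 hpos.le)
      · exact (le_div_iff₀ hpos).2 (RealQuantum.mul_imaginarity_le hψ hρ.2 hp hp0)
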